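/- Let $n \ge 0$ and $p \ge 1$ be integers and let $\mu$ be a Borel probability measure on $\mathbb{R}^{n\times n}$ with bounded support. Write $\|\cdot\|$ for the Euclidean norm on vectors and for the maximal singular value on matrices, let $A, A_0, A_1, A_2, \dots$ be independent random matrices following $\mu$, and let $\Sigma_\mu$ be the stochastic switched linear system $x(k+1) = A_k x(k)$, $x(0) = x_0 \in \mathbb{R}^n$. Definitions. (a) The $L^p$-norm joint spectral radius of $\mu$ is $\rho_{p,\mu} = \lim_{k\to\infty} \left(E\|A_{k-1}\cdots A_1A_0\|^p\right)^{1/(pk)}$. (b) $\Sigma_\mu$ is $p$-th mean stable if there are $C > 0$ and $\gamma_0 \in [0,1)$ with $E\|x(k)\|^p \le C\gamma_0^{pk}\|x_0\|^p$ for all $x_0 \in \mathbb{R}^n$ and all $k \ge 0$. (c) A set $K \subset \mathbb{R}^m$ closed under multiplication by nonnegative numbers is a proper cone if it is closed, convex, has nonempty interior, and $x, -x \in K$ implies $x = 0$. A set of matrices leaves $K$ invariant if each of its elements maps $K$ into $K$. The dual cone is $K^* = \{f \in \mathbb{R}^m : f^\top x \ge 0 \text{ for all } x \in K\}$. (d)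 A norm $N$ on $\mathbb{R}^m$ is cone linear absolute if there is a proper cone $K \subset \mathbb{R}^m$ such that $N(x) = \inf\{N(v+w) : v, w \in K,\ x = v - w\}$ for every $x \in \mathbb{R}^m$, and there is $f \in K^*$ with $N(x) = f^\top x$ for every $x \in K$. (e) A function $V : \mathbb{R}^n \to \mathbb{R}$ is a stochastic Lyapunov function of degree $p$ for $\Sigma_\mu$ with growth rate $\gamma \in [0,1)$ if there are $C_1, C_2 > 0$ with $C_1\|x\|^p \le V(x) \le C_2\|x\|^p$ for all $x \in \mathbb{R}^n$, and, for all $x \in \mathbb{R}^n$, $V(Ax)$ is integrable with $E[V(Ax)] \le \gamma^p V(x)$. (f) $x^{\otimes p} \in \mathbb{R}^{n^p}$ is the $p$-th Kronecker power of $x \in \mathbb{R}^n$. Theorem. Suppose that $\Sigma_\mu$ is $p$-th mean stable and that $\operatorname{supp}\mu$ leaves a proper cone in $\mathbb{R}^n$ invariant. Then for every $\gamma \in (\rho_{p,\mu}, 1)$ there exists a cone linear absolute norm $N$ on $\mathbb{R}^{n^p}$ such that $V(x) = N(x^{\otimes p})$ is a stochastic Lyapunov function of degree $p$ for $\Sigma_\mu$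 with growth rate $\gamma$. -/

import Mathlib

open MeasureTheory Filter Topology Set
open scoped Matrix.Norms.L2Operator

namespace SwitchedLinear

/-- Real `n × n` matrices; `‖A‖` is the largest singular value of `A`. -/
abbrev Mat (n : ℕ) : Type := Matrix (Fin n) (Fin n) ℝ

/-- `ℝⁿ` with the Euclidean norm. -/
abbrev Vec (n : ℕ) : Type := EuclideanSpace ℝ (Fin n)

/-- The (entrywise) Borel σ-algebra on real matrices. -/
instance instMeasurableSpaceMat (n : ℕ) : MeasurableSpace (Mat n) :=
  inferInstanceAs (MeasurableSpace (Fin n → Fin n → ℝ))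

instance instBorelSpaceMat (n : ℕ) : BorelSpace (Mat n) :=
  inferInstanceAs (BorelSpace (Fin n → Fin n → ℝ))

noncomputable section

/-- The product `A x` of a matrix and a vector. -/
def act {n : ℕ} (A : Mat n) (x : Vec n) : Vec n := Matrix.toEuclideanLin A x

/-! ### Cones and norms -/

/-- A proper cone: closed under multiplication by nonnegative numbers, closed, convex,
solid and pointed. -/
structure IsProperCone {n : ℕ} (K : Set (Vec n)) : Prop where
  smul_mem : ∀ c : ℝ, 0 ≤ c → ∀ x ∈ K, c • x ∈ K
  isClosed : IsClosed K
  convex : Convex ℝ K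
  solid : (interior K).Nonempty
  pointed : ∀ x, x ∈ K → -x ∈ K → x = 0

/-- Every matrix of the set `M` maps `K` into `K`. -/
def LeavesInvariant {n : ℕ} (M : Set (Mat n)) (K : Set (Vec n)) : Prop :=
  ∀ A ∈ M, ∀ x ∈ K, act A x ∈ K

/-- The dual cone `K* = {f | fᵀ x ≥ 0 for every x ∈ K}`. -/
def dualCone {n : ℕ} (K : Set (Vec n)) : Set (Vec n) :=
  {f | ∀ x ∈ K, 0 ≤ inner ℝ f x}

/-- A seminorm is a norm if it vanishes only at `0`. -/
def IsNorm {n : ℕ} (N : Seminorm ℝ (Vec n)) : Prop := ∀ x, N x = 0 → x = 0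

/-- `N x` is the infimum of `N (v + w)` over `v, w ∈ K` with `x = v - w`, for every `x`. -/
def IsConeAbsolute {n : ℕ} (N : Seminorm ℝ (Vec n)) (K : Set (Vec n)) : Prop :=
  ∀ x, IsGLB {r : ℝ | ∃ v ∈ K, ∃ w ∈ K, x = v - w ∧ r = N (v + w)} (N x)

/-- On `K`, `N` coincides with some `f` in the dual cone. -/
def IsConeLinear {n : ℕ} (N : Seminorm ℝ (Vec n)) (K : Set (Vec n)) : Prop :=
  ∃ f ∈ dualCone K, ∀ x ∈ K, N x = inner ℝ f x

/-- A norm that is cone linear and cone absolute with respect to a common proper cone. -/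
def IsConeLinearAbsoluteNorm {n : ℕ} (N : Seminorm ℝ (Vec n)) : Prop :=
  IsNorm N ∧ ∃ K, IsProperCone K ∧ IsConeLinear N K ∧ IsConeAbsolute N K

/-! ### Kronecker powers -/

/-- The Kronecker power `x^{⊗p} ∈ ℝ^{n^p}`: its `i`-th entry is the product of the entries of `x`
at the `p` base-`n` digits of `i`. -/
def kronPow {n : ℕ} (p : ℕ) (x : Vec n) : Vec (n ^ p) :=
  WithLp.toLp 2 fun i => ∏ j : Fin p, x (finFunctionFinEquiv.symm i j)

/-- The recursion `x^{⊗(p+1)} = x^{⊗p} ⊗ x` for the Kronecker product with its usual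
(lexicographic) ordering of the entries. -/
theorem kronPow_succ {n : ℕ} (p : ℕ) (x : Vec n) (i : Fin (n ^ p)) (j : Fin n) :
    kronPow (p + 1) x (finProdFinEquiv (i, j) : Fin (n ^ p * n)) = kronPow p x i * x j := by
  have hn : 0 < n := j.pos
  set q : Fin (n ^ (p + 1)) := (finProdFinEquiv (i, j) : Fin (n ^ p * n)) with hq
  have hv : (q : ℕ) = (j : ℕ) + n * (i : ℕ) := rfl
  have h0 : finFunctionFinEquiv.symm q 0 = j := by
    apply Fin.ext
    rw [finFunctionFinEquiv_symm_apply_val, hv]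
    simp [Nat.mod_eq_of_lt j.isLt]
  have hs : ∀ b : Fin p, finFunctionFinEquiv.symm q b.succ = finFunctionFinEquiv.symm i b := by
    intro b
    apply Fin.ext
    rw [finFunctionFinEquiv_symm_apply_val, finFunctionFinEquiv_symm_apply_val, hv, Fin.val_succ,
      pow_succ', ← Nat.div_div_eq_div_mul, Nat.add_mul_div_left _ _ hn,
      Nat.div_eq_of_lt j.isLt, zero_add]
  simp only [kronPow]
  rw [Fin.prod_univ_succ, h0, mul_comm]
  simp only [hs]

/-! ### The stochastic switched linear system `x(k+1) = A_k x(k)`, `A_k ∼ μ` i.i.d. -/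

/-- The product `A_{k-1} ⋯ A_1 A_0` of the first `k` matrices of a sequence. -/
def matProd {n : ℕ} (A : ℕ → Mat n) : ℕ → Mat n
  | 0 => 1
  | k + 1 => A k * matProd A k

/-- The trajectory `x(0) = x₀`, `x(k+1) = A_k x(k)`. -/
def trajectory {n : ℕ} (A : ℕ → Mat n) (x₀ : Vec n) : ℕ → Vec n
  | 0 => x₀
  | k + 1 => act (A k) (trajectory A x₀ k)

/-- The law of a sequence `A_0, A_1, …` of independent random matrices, each following `μ`. -/
def iidLaw {n : ℕ} (μ : Measure (Mat n)) [IsProbabilityMeasure μ] : Measure (ℕ → Mat n) :=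
  Measure.infinitePi fun _ : ℕ => μ

/-- The `L^p`-norm joint spectral radius
`ρ_{p,μ} = lim_{k → ∞} (E ‖A_{k-1} ⋯ A_0‖^p)^{1/(pk)}`. -/
def pRadius {n : ℕ} (p : ℕ) (μ : Measure (Mat n)) [IsProbabilityMeasure μ] : ℝ :=
  limUnder atTop fun k : ℕ =>
    (∫ A, ‖matProd A k‖ ^ p ∂(iidLaw μ)) ^ ((1 : ℝ) / ((p : ℝ) * (k : ℝ)))

/-- Exponential stability in `p`-th mean of the system driven by `μ`. -/
def IsMeanStable {n : ℕ} (p : ℕ) (μ : Measure (Mat n)) [IsProbabilityMeasure μ] : Prop :=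
  ∃ C : ℝ, 0 < C ∧ ∃ γ : ℝ, 0 ≤ γ ∧ γ < 1 ∧ ∀ (x₀ : Vec n) (k : ℕ),
    Integrable (fun A => ‖trajectory A x₀ k‖ ^ p) (iidLaw μ) ∧
      ∫ A, ‖trajectory A x₀ k‖ ^ p ∂(iidLaw μ) ≤ C * γ ^ (p * k) * ‖x₀‖ ^ p

/-- `V` is a stochastic Lyapunov function of degree `p` with growth rate `γ` for the system
driven by `μ`. -/
structure IsStochLyapunov {n : ℕ} (p : ℕ) (μ : Measure (Mat n)) (V : Vec n → ℝ) (γ : ℝ) :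
    Prop where
  bounds : ∃ C₁ C₂ : ℝ, 0 < C₁ ∧ 0 < C₂ ∧ ∀ x, C₁ * ‖x‖ ^ p ≤ V x ∧ V x ≤ C₂ * ‖x‖ ^ p
  rate_nonneg : 0 ≤ γ
  rate_lt_one : γ < 1
  integrable : ∀ x, Integrable (fun A => V (act A x)) μ
  decrease : ∀ x, ∫ A, V (act A x) ∂μ ≤ γ ^ p * V x

end

end SwitchedLinear

/-!
The matrices `A^{⊗p}` with `A ∈ supp μ` leave invariant the tensor power of the given cone, which
is again a proper cone, and hence so does their mean `M = E[A^{⊗p}]`. By independence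
`M ^ k = E[(A_{k-1} ⋯ A_0)^{⊗p}]`, whose norm is at most a constant times
`E ‖A_{k-1} ⋯ A_0‖ ^ p = o(γ ^ (p * k))`. A functional `f₀` that is positive on the nonzero vectors
of the tensor cone therefore yields one contracted by `M`, namely
`f = ∑ j < k, γ ^ (-p * j) • f₀ ∘ M ^ j` for a suitable `k`: it satisfies `f ∘ M ≤ γ ^ p • f` on the
cone. The cone linear absolute norm `N` induced by `f` inherits
`E[N (A^{⊗p} z)] ≤ γ ^ p * N z`, and `A^{⊗p} x^{⊗p} = (A x)^{⊗p}`.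
-/

namespace SwitchedLinear

/-! ### Growth of submultiplicative sequences -/

lemma le_pow_of_root_le {a d : ℝ} (ha : 0 ≤ a) {k : ℕ} (hk : k ≠ 0)
    (h : a ^ ((1 : ℝ) / k) ≤ d) : a ≤ d ^ k := by
  rw [one_div] at h
  rw [← Real.rpow_inv_natCast_pow ha hk]
  exact pow_le_pow_left₀ (Real.rpow_nonneg ha _) h k

section Submultiplicative

variable {c : ℕ → ℝ}

lemma exists_le_mul_pow_of_submultiplicative (hc : ∀ k, 0 ≤ c k)
    (hmul : ∀ j k, c (j + k) ≤ c j * c k) {q : ℕ} (hq : q ≠ 0) {d : ℝ} (hd : 0 < d)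
    (hcq : c q ≤ d ^ q) : ∃ M, 0 < M ∧ ∀ k, c k ≤ M * d ^ k := by
  obtain ⟨M, hM⟩ := ((Finset.range q).image fun r => c r / d ^ r).bddAbove
  refine ⟨max M 1, by positivity, fun k => ?_⟩
  induction k using Nat.strong_induction_on with
  | _ k ih =>
    rcases lt_or_ge k q with hk | hk
    · rw [← div_le_iff₀ (by positivity)]
      exact (hM <| Finset.mem_coe.2 <| Finset.mem_image_of_mem _ <| Finset.mem_range.2 hk).trans
        (le_max_left M 1)
    · obtain ⟨l, rfl⟩ := Nat.exists_eq_add_of_le hk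
      calc c (q + l) ≤ c q * c l := hmul q l
        _ ≤ d ^ q * (max M 1 * d ^ l) :=
          mul_le_mul hcq (ih l (by lia)) (hc l) (by positivity)
        _ = max M 1 * d ^ (q + l) := by ring

lemma eventually_root_lt_of_le_mul_pow (hc : ∀ k, 0 ≤ c k) {M d δ : ℝ} (hM : 0 < M) (hd : 0 < d)
    (h : ∀ k, c k ≤ M * d ^ k) (hδ : d < δ) : ∀ᶠ k : ℕ in atTop, c k ^ ((1 : ℝ) / k) < δ := by
  have hlim : Tendsto (fun k : ℕ => M ^ ((1 : ℝ) / k) * d) atTop (𝓝 d) := by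
    simpa using ((Real.continuousAt_const_rpow hM.ne').tendsto.comp
      tendsto_one_div_atTop_nhds_zero_nat).mul_const d
  filter_upwards [hlim.eventually_lt_const hδ, eventually_ne_atTop 0] with k hk hk0
  calc c k ^ ((1 : ℝ) / k) ≤ (M * d ^ k) ^ ((1 : ℝ) / k) :=
        Real.rpow_le_rpow (hc k) (h k) (by positivity)
    _ = M ^ ((1 : ℝ) / k) * d := by
        rw [Real.mul_rpow hM.le (by positivity), one_div, Real.pow_rpow_inv_natCast hd.le hk0]
    _ < δ := hk

-- A multiplicative Fekete lemma; `Subadditive` does not apply to `log ∘ c`, as `c` may vanish.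
lemma exists_tendsto_root_of_submultiplicative (hc : ∀ k, 0 ≤ c k)
    (hmul : ∀ j k, c (j + k) ≤ c j * c k) :
    ∃ L, Tendsto (fun k : ℕ => c k ^ ((1 : ℝ) / k)) atTop (𝓝 L) := by
  set S : Set ℝ := (fun k : ℕ => c k ^ ((1 : ℝ) / k)) '' {0}ᶜ
  have hS0 : 0 ∈ lowerBounds S := by
    rintro _ ⟨k, -, rfl⟩
    exact Real.rpow_nonneg (hc k) _
  have hSne : S.Nonempty := ⟨_, 1, one_ne_zero, rfl⟩
  refine ⟨sInf S, tendsto_order.2 ⟨fun a ha => ?_, fun δ hδ => ?_⟩⟩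
  · filter_upwards [eventually_ne_atTop 0] with k hk
    exact ha.trans_le (csInf_le ⟨0, hS0⟩ ⟨k, hk, rfl⟩)
  · obtain ⟨_, ⟨q, hq, rfl⟩, hlt⟩ := exists_lt_of_csInf_lt hSne hδ
    obtain ⟨d, hqd, hdδ⟩ := exists_between hlt
    have hd : 0 < d := (Real.rpow_nonneg (hc q) _).trans_lt hqd
    obtain ⟨M, hM, h⟩ := exists_le_mul_pow_of_submultiplicative hc hmul hq hd
      (le_pow_of_root_le (hc q) hq hqd.le)
    exact eventually_root_lt_of_le_mul_pow hc hM hd h hdδ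

lemma isLittleO_pow_of_tendsto_root (hc : ∀ k, 0 ≤ c k) {L g : ℝ}
    (hL : Tendsto (fun k : ℕ => c k ^ ((1 : ℝ) / k)) atTop (𝓝 L)) (hg : L < g) :
    c =o[atTop] fun k => g ^ k := by
  have hL0 : 0 ≤ L := ge_of_tendsto' hL fun k => Real.rpow_nonneg (hc k) _
  obtain ⟨d, hLd, hdg⟩ := exists_between hg
  have hd : 0 ≤ d := hL0.trans hLd.le
  refine Asymptotics.IsBigO.trans_isLittleO (g := fun k => d ^ k) (.of_bound' ?_)
    (isLittleO_pow_pow_of_lt_left hd hdg)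
  filter_upwards [hL.eventually_lt_const hLd, eventually_ne_atTop 0] with k hk hk0
  rw [Real.norm_of_nonneg (hc k), Real.norm_of_nonneg (pow_nonneg hd k)]
  exact le_pow_of_root_le (hc k) hk0 hk.le

end Submultiplicative

/-! ### The seminorm induced by a cone and a positive functional -/

section ConeSeminorm

variable {E : Type*} [AddCommGroup E] [Module ℝ E] {C : PointedCone ℝ E}

/-- The values `f (v + w)` over the decompositions `x = v - w` with `v, w ∈ C`; their infimum is
the seminorm that a positive functional `f` induces on the space. -/
def splitValues (C : PointedCone ℝ E) (f : E →ₗ[ℝ] ℝ) (x : E) : Set ℝ :=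
  {r | ∃ v ∈ C, ∃ w ∈ C, x = v - w ∧ r = f (v + w)}

lemma splitValues_nonempty (hC : (C : ConvexCone ℝ E).IsReproducing) (f : E →ₗ[ℝ] ℝ) (x : E) :
    (splitValues C f x).Nonempty := by
  obtain ⟨v, hv, w, hw, rfl⟩ := Set.mem_sub.1 (hC.sub_eq_univ ▸ mem_univ x)
  exact ⟨_, v, hv, w, hw, rfl, rfl⟩

variable {f : E →ₗ[ℝ] ℝ}

lemma zero_mem_lowerBounds_splitValues (hf : ∀ x ∈ C, 0 ≤ f x) (x : E) :
    0 ∈ lowerBounds (splitValues C f x) := by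
  rintro _ ⟨v, hv, w, hw, -, rfl⟩
  exact hf _ (add_mem hv hw)

lemma add_mem_splitValues {x y : E} {r s : ℝ} (hr : r ∈ splitValues C f x)
    (hs : s ∈ splitValues C f y) : r + s ∈ splitValues C f (x + y) := by
  obtain ⟨v, hv, w, hw, rfl, rfl⟩ := hr
  obtain ⟨v', hv', w', hw', rfl, rfl⟩ := hs
  exact ⟨v + v', add_mem hv hv', w + w', add_mem hw hw', by abel,
    by rw [← map_add, add_add_add_comm]⟩

lemma abs_mul_mem_splitValues {x : E} {r : ℝ} (hr : r ∈ splitValues C f x) (a : ℝ) :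
    |a| * r ∈ splitValues C f (a • x) := by
  obtain ⟨v, hv, w, hw, rfl, rfl⟩ := hr
  rcases le_total 0 a with ha | ha
  · refine ⟨a • v, C.smul_mem ha hv, a • w, C.smul_mem ha hw, smul_sub a v w, ?_⟩
    rw [← smul_add, map_smul, smul_eq_mul, abs_of_nonneg ha]
  · have ha' : 0 ≤ -a := neg_nonneg.2 ha
    refine ⟨-a • w, C.smul_mem ha' hw, -a • v, C.smul_mem ha' hv, by module, ?_⟩
    rw [← smul_add, map_smul, smul_eq_mul, abs_of_nonpos ha, add_comm]

/-- The seminorm `x ↦ inf {f (v + w) | v, w ∈ C, x = v - w}` induced by a functional `f` that is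
nonnegative on a reproducing cone `C`. -/
noncomputable def coneSeminorm (hC : (C : ConvexCone ℝ E).IsReproducing)
    (hf : ∀ x ∈ C, 0 ≤ f x) : Seminorm ℝ E :=
  have bdd x : BddBelow (splitValues C f x) := ⟨0, zero_mem_lowerBounds_splitValues hf x⟩
  have nonempty := splitValues_nonempty hC f
  .ofSMulLE (fun x => sInf (splitValues C f x))
    (le_antisymm (csInf_le (bdd 0) ⟨0, C.zero_mem, 0, C.zero_mem, by simp, by simp⟩)
      (le_csInf (nonempty 0) (zero_mem_lowerBounds_splitValues hf 0)))
    (fun x y => by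
      rw [← csInf_add (nonempty x) (bdd x) (nonempty y) (bdd y)]
      refine csInf_le_csInf (bdd _) ((nonempty x).add (nonempty y)) ?_
      rintro _ ⟨r, hr, s, hs, rfl⟩
      exact add_mem_splitValues hr hs)
    (fun a x => by
      rw [Real.norm_eq_abs, ← smul_eq_mul, ← Real.sInf_smul_of_nonneg (abs_nonneg a)]
      refine csInf_le_csInf (bdd _) ((nonempty x).smul_set) ?_
      rintro _ ⟨r, hr, rfl⟩
      exact abs_mul_mem_splitValues hr a)

variable (hC : (C : ConvexCone ℝ E).IsReproducing) (hf : ∀ x ∈ C, 0 ≤ f x)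

lemma isGLB_coneSeminorm (x : E) : IsGLB (splitValues C f x) (coneSeminorm hC hf x) :=
  isGLB_csInf (splitValues_nonempty hC f x) ⟨0, zero_mem_lowerBounds_splitValues hf x⟩

lemma coneSeminorm_sub_le {v w : E} (hv : v ∈ C) (hw : w ∈ C) :
    coneSeminorm hC hf (v - w) ≤ f (v + w) :=
  (isGLB_coneSeminorm hC hf _).1 ⟨v, hv, w, hw, rfl, rfl⟩

lemma coneSeminorm_of_mem {x : E} (hx : x ∈ C) : coneSeminorm hC hf x = f x := by
  refine le_antisymm (by simpa using coneSeminorm_sub_le hC hf hx C.zero_mem) ?_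
  refine (isGLB_coneSeminorm hC hf x).2 ?_
  rintro _ ⟨v, -, w, hw, rfl, rfl⟩
  rw [map_sub, map_add]
  linarith [hf w hw]

lemma coneSeminorm_splitValues_eq (x : E) :
    {r | ∃ v ∈ C, ∃ w ∈ C, x = v - w ∧ r = coneSeminorm hC hf (v + w)} = splitValues C f x := by
  ext r
  refine exists_congr fun v => and_congr_right fun hv => exists_congr fun w =>
    and_congr_right fun hw => ?_
  rw [coneSeminorm_of_mem hC hf (add_mem hv hw)]

lemma le_mul_coneSeminorm {a g : ℝ} (hg : 0 ≤ g) {x : E}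
    (h : ∀ v ∈ C, ∀ w ∈ C, x = v - w → a ≤ g * f (v + w)) : a ≤ g * coneSeminorm hC hf x := by
  rcases hg.eq_or_lt with rfl | hg
  · obtain ⟨_, v, hv, w, hw, hx, -⟩ := splitValues_nonempty hC f x
    simpa only [zero_mul] using h v hv w hw hx
  · rw [← div_le_iff₀' hg]
    refine (isGLB_coneSeminorm hC hf x).2 ?_
    rintro _ ⟨v, hv, w, hw, hx, rfl⟩
    exact (div_le_iff₀' hg).2 (h v hv w hw hx)

lemma integral_coneSeminorm_le {Ω : Type*} [MeasurableSpace Ω] {μ : Measure Ω} {T : Ω → E →ₗ[ℝ] E}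
    (hT : ∀ᵐ ω ∂μ, ∀ x ∈ C, T ω x ∈ C) (hint : ∀ x ∈ C, Integrable (fun ω => f (T ω x)) μ) {g : ℝ}
    (hg : 0 ≤ g) (h : ∀ x ∈ C, ∫ ω, f (T ω x) ∂μ ≤ g * f x) (x : E) :
    ∫ ω, coneSeminorm hC hf (T ω x) ∂μ ≤ g * coneSeminorm hC hf x := by
  refine le_mul_coneSeminorm hC hf hg fun v hv w hw hx => ?_
  have hvw : v + w ∈ C := add_mem hv hw
  refine le_trans (integral_mono_of_nonneg (ae_of_all _ fun ω => apply_nonneg _ _)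
    (hint _ hvw) ?_) (h _ hvw)
  filter_upwards [hT] with ω hω
  rw [hx, map_sub, map_add]
  exact coneSeminorm_sub_le hC hf (hω v hv) (hω w hw)

end ConeSeminorm

section NormedConeSeminorm

variable {E : Type*} [NormedAddCommGroup E] [NormedSpace ℝ E] {C : PointedCone ℝ E}
  {f : E →ₗ[ℝ] ℝ}

lemma mul_norm_le_coneSeminorm (hC : (C : ConvexCone ℝ E).IsReproducing)
    (hf : ∀ x ∈ C, 0 ≤ f x) {c : ℝ} (hc : 0 ≤ c) (hfc : ∀ x ∈ C, c * ‖x‖ ≤ f x) (x : E) :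
    c * ‖x‖ ≤ coneSeminorm hC hf x := by
  refine (isGLB_coneSeminorm hC hf x).2 ?_
  rintro _ ⟨v, hv, w, hw, rfl, rfl⟩
  calc c * ‖v - w‖ ≤ c * (‖v‖ + ‖w‖) := by gcongr; exact norm_sub_le v w
    _ = c * ‖v‖ + c * ‖w‖ := mul_add _ _ _
    _ ≤ f v + f w := add_le_add (hfc v hv) (hfc w hw)
    _ = f (v + w) := (map_add f v w).symm

end NormedConeSeminorm

/-! ### Contracted functionals -/

section ContractedFunctional

lemma sum_iterate_apply_le {α : Type*} {φ : α → ℝ} {T : α → α} {g : ℝ} (hg : 0 < g) {k : ℕ} {x : α}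
    (hk : φ (T^[k] x) ≤ g ^ k * φ x) :
    ∑ j ∈ Finset.range k, g⁻¹ ^ j * φ (T^[j] (T x)) ≤
      g * ∑ j ∈ Finset.range k, g⁻¹ ^ j * φ (T^[j] x) := by
  have hshift : ∀ j, g⁻¹ ^ j * φ (T^[j] (T x)) = g * (g⁻¹ ^ (j + 1) * φ (T^[j + 1] x)) := by
    intro j
    rw [Function.iterate_succ_apply, pow_succ]
    field_simp
  have hlast : g⁻¹ ^ k * φ (T^[k] x) ≤ φ x := by
    rwa [inv_pow, inv_mul_le_iff₀ (by positivity)]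
  have htelescope := (Finset.sum_range_succ' (fun j => g⁻¹ ^ j * φ (T^[j] x)) k).symm.trans
    (Finset.sum_range_succ _ k)
  rw [pow_zero, one_mul, Function.iterate_zero_apply] at htelescope
  simp only [hshift, ← Finset.mul_sum]
  exact mul_le_mul_of_nonneg_left (by linarith) hg.le

variable {E : Type*} [NormedAddCommGroup E] [NormedSpace ℝ E] {S : Set E} {B : E →L[ℝ] E}
  {f₀ : E →L[ℝ] ℝ} {c g : ℝ}

lemma exists_iterate_apply_le (hc : 0 < c) (hf₀ : ∀ z ∈ S, c * ‖z‖ ≤ f₀ z) (hg : 0 < g)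
    (hBg : (fun k => B ^ k) =o[atTop] fun k => g ^ k) :
    ∃ k ≠ 0, ∀ z ∈ S, f₀ (B^[k] z) ≤ g ^ k * f₀ z := by
  obtain ⟨k, hk, hk0⟩ := ((hBg.def (c := c / (‖f₀‖ + 1)) (by positivity)).and
    (eventually_ne_atTop 0)).exists
  rw [Real.norm_of_nonneg (by positivity), div_mul_eq_mul_div, le_div_iff₀ (by positivity)] at hk
  refine ⟨k, hk0, fun z hz => ?_⟩
  calc f₀ (B^[k] z) = f₀ ((B ^ k) z) := by rw [FunLike.coe_pow_eq_iterate]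
    _ ≤ ‖f₀‖ * (‖B ^ k‖ * ‖z‖) := (le_abs_self _).trans (f₀.le_opNorm_of_le ((B ^ k).le_opNorm z))
    _ ≤ ‖B ^ k‖ * (‖f₀‖ + 1) * ‖z‖ := by linarith [show 0 ≤ ‖B ^ k‖ * ‖z‖ by positivity]
    _ ≤ c * g ^ k * ‖z‖ := by gcongr
    _ = g ^ k * (c * ‖z‖) := by ring
    _ ≤ g ^ k * f₀ z := by gcongr; exact hf₀ z hz

-- The witness is `f = ∑ j < k, g⁻ʲ • f₀ ∘ Bʲ` with `k` such that `f₀ ∘ Bᵏ ≤ gᵏ f₀` on `S`.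
lemma exists_contracted_functional (hB : MapsTo B S S) (hc : 0 < c)
    (hf₀ : ∀ z ∈ S, c * ‖z‖ ≤ f₀ z) (hg : 0 < g)
    (hBg : (fun k => B ^ k) =o[atTop] fun k => g ^ k) :
    ∃ f : E →L[ℝ] ℝ, (∀ z ∈ S, c * ‖z‖ ≤ f z) ∧ ∀ z ∈ S, f (B z) ≤ g * f z := by
  obtain ⟨k, hk0, hk⟩ := exists_iterate_apply_le hc hf₀ hg hBg
  have hsum (z : E) : (∑ j ∈ Finset.range k, g⁻¹ ^ j • f₀ ∘L B ^ j) z =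
      ∑ j ∈ Finset.range k, g⁻¹ ^ j * f₀ (B^[j] z) := by
    simp
  refine ⟨∑ j ∈ Finset.range k, g⁻¹ ^ j • f₀ ∘L B ^ j, fun z hz => ?_, fun z hz => ?_⟩
  · rw [hsum]
    have hterm : ∀ j ∈ Finset.range k, 0 ≤ g⁻¹ ^ j * f₀ (B^[j] z) := fun j _ =>
      mul_nonneg (by positivity)
        ((by positivity : 0 ≤ c * ‖B^[j] z‖).trans (hf₀ _ (hB.iterate j hz)))
    calc c * ‖z‖ ≤ f₀ z := hf₀ z hz
      _ = g⁻¹ ^ 0 * f₀ (B^[0] z) := by rw [pow_zero, one_mul, Function.iterate_zero_apply]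
      _ ≤ _ := Finset.single_le_sum hterm (Finset.mem_range.2 (Nat.pos_of_ne_zero hk0))
  · rw [hsum, hsum]
    exact sum_iterate_apply_le hg (hk z hz)

end ContractedFunctional

/-! ### Cones and their duals -/

lemma isReproducing_of_interior_nonempty {E : Type*} [AddCommGroup E] [Module ℝ E]
    [TopologicalSpace E] [ContinuousAdd E] [ContinuousSMul ℝ E] {C : PointedCone ℝ E}
    (hC : (interior (C : Set E)).Nonempty) : (C : ConvexCone ℝ E).IsReproducing := by
  cases subsingleton_or_nontrivial E
  · exact .of_univ_subset fun x _ => ⟨0, C.zero_mem, 0, C.zero_mem, Subsingleton.elim _ _⟩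
  · refine .of_span_eq_top (Submodule.eq_top_of_nonempty_interior' _ ?_)
    exact hC.mono (interior_mono Submodule.subset_span)

section InnerDual

variable {E : Type*} [NormedAddCommGroup E] [InnerProductSpace ℝ E] [CompleteSpace E]

open ProperCone

lemma exists_mul_norm_le_inner_of_mem_interior {S : Set E} {x : E} (hx : x ∈ interior S) :
    ∃ c, 0 < c ∧ ∀ f ∈ innerDual S, c * ‖f‖ ≤ inner ℝ f x := by
  obtain ⟨r, hr, hball⟩ := Metric.mem_nhds_iff.1 (mem_interior_iff_mem_nhds.1 hx)
  refine ⟨r / 2, half_pos hr, fun f hf => ?_⟩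
  rcases eq_or_ne f 0 with rfl | hf0
  · simp
  have hmem : x - (r / 2 / ‖f‖) • f ∈ S := hball <| by
    rw [Metric.mem_ball, dist_eq_norm, sub_sub_cancel_left, norm_neg, norm_smul,
      Real.norm_of_nonneg (by positivity), div_mul_cancel₀ _ (norm_ne_zero_iff.2 hf0)]
    exact half_lt_self hr
  have h := mem_innerDual.1 hf hmem
  rw [real_inner_comm, inner_sub_right, real_inner_smul_right, real_inner_self_eq_norm_sq,
    sub_nonneg] at h
  calc r / 2 * ‖f‖ = r / 2 / ‖f‖ * ‖f‖ ^ 2 := by field_simp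
    _ ≤ inner ℝ f x := h

lemma mem_interior_innerDual {S : Set E} {c : ℝ} (hc : 0 < c) {x : E}
    (hx : ∀ f ∈ S, c * ‖f‖ ≤ inner ℝ f x) : x ∈ interior (innerDual S : Set E) := by
  refine mem_interior_iff_mem_nhds.2 (Metric.mem_nhds_iff.2 ⟨c, hc, fun y hy => ?_⟩)
  refine mem_innerDual.2 fun f hf => ?_
  have hfy : inner ℝ f (x - y) ≤ ‖f‖ * c := (real_inner_le_norm _ _).trans <| by
    rw [← dist_eq_norm']
    gcongr
    exact (Metric.mem_ball.1 hy).le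
  rw [inner_sub_right] at hfy
  linarith [hx f hf]

end InnerDual

section SalientCone

variable {E : Type*} [NormedAddCommGroup E] [InnerProductSpace ℝ E] [FiniteDimensional ℝ E]

open ProperCone

lemma interior_nonempty_of_span_eq_top {C : PointedCone ℝ E}
    (hC : Submodule.span ℝ (C : Set E) = ⊤) : (interior (C : Set E)).Nonempty := by
  rw [C.convex.interior_nonempty_iff_affineSpan_eq_top, ← insert_eq_of_mem C.zero_mem]
  refine SetLike.coe_injective ?_
  rw [affineSpan_insert_zero, hC]
  rfl

lemma span_eq_top_iff_forall_inner_eq_zero {S : Set E} :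
    Submodule.span ℝ S = ⊤ ↔ ∀ x, (∀ f ∈ S, inner ℝ f x = 0) → x = 0 := by
  rw [← Submodule.orthogonal_eq_bot_iff, Submodule.eq_bot_iff]
  refine forall_congr' fun x => imp_congr_left ⟨fun h f hf => h f (Submodule.subset_span hf), ?_⟩
  intro h
  have hle : Submodule.span ℝ S ≤ (ℝ ∙ x)ᗮ := Submodule.span_le.2 fun f hf =>
    Submodule.mem_orthogonal_singleton_iff_inner_left.2 (h f hf)
  exact fun u hu => Submodule.mem_orthogonal_singleton_iff_inner_left.1 (hle hu)

lemma span_innerDual_eq_top {C : ProperCone ℝ E} (hC : ∀ x ∈ C, -x ∈ C → x = 0) :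
    Submodule.span ℝ (innerDual (C : Set E) : Set E) = ⊤ := by
  refine span_eq_top_iff_forall_inner_eq_zero.2 fun x hx => ?_
  have hmem : x ∈ innerDual (innerDual (C : Set E) : Set E) := fun f hf => (hx f hf).ge
  have hneg : -x ∈ innerDual (innerDual (C : Set E) : Set E) := fun f hf => by
    simpa only [innerₗ_apply_apply, inner_neg_right, Left.nonneg_neg_iff] using (hx f hf).le
  rw [innerDual_innerDual] at hmem hneg
  exact hC x hmem hneg

lemma exists_mul_norm_le_inner {C : ProperCone ℝ E} (hC : ∀ x ∈ C, -x ∈ C → x = 0) :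
    ∃ f : E, ∃ c, 0 < c ∧ ∀ x ∈ C, c * ‖x‖ ≤ inner ℝ f x := by
  obtain ⟨f, hf⟩ := interior_nonempty_of_span_eq_top (C := (innerDual (C : Set E)).toPointedCone)
    (span_innerDual_eq_top hC)
  obtain ⟨c, hc, h⟩ := exists_mul_norm_le_inner_of_mem_interior hf
  refine ⟨f, c, hc, fun x hx => ?_⟩
  rw [real_inner_comm]
  exact h x (by rwa [← innerDual_innerDual C] at hx)

end SalientCone

section EuclideanCone

variable {n : ℕ}

lemma IsProperCone.zero_mem {K : Set (Vec n)} (hK : IsProperCone K) : (0 : Vec n) ∈ K := by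
  obtain ⟨x, hx⟩ := hK.solid
  simpa only [zero_smul] using hK.smul_mem 0 le_rfl x (interior_subset hx)

lemma IsProperCone.add_mem {K : Set (Vec n)} (hK : IsProperCone K) {x y : Vec n}
    (hx : x ∈ K) (hy : y ∈ K) : x + y ∈ K := by
  have hmid := hK.convex hx hy (a := 1 / 2) (b := 1 / 2) (by norm_num) (by norm_num) (by norm_num)
  simpa [smul_smul] using hK.smul_mem 2 zero_le_two _ hmid

/-- A proper cone of `ℝⁿ` as a `ProperCone` of Mathlib, which need be neither solid nor pointed. -/
def IsProperCone.toProperCone {K : Set (Vec n)} (hK : IsProperCone K) : ProperCone ℝ (Vec n) where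
  carrier := K
  add_mem' := hK.add_mem
  zero_mem' := hK.zero_mem
  smul_mem' c x hx := hK.smul_mem c c.2 x hx
  isClosed' := hK.isClosed

lemma isProperCone_innerDual {S : Set (Vec n)} (hS : Submodule.span ℝ S = ⊤) {c : ℝ} (hc : 0 < c)
    {x : Vec n} (hx : ∀ f ∈ S, c * ‖f‖ ≤ inner ℝ f x) :
    IsProperCone (ProperCone.innerDual S : Set (Vec n)) where
  smul_mem _ ha _ hy := (ProperCone.innerDual S).toPointedCone.smul_mem ha hy
  isClosed := (ProperCone.innerDual S).isClosed
  convex := (ProperCone.innerDual S).toPointedCone.convex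
  solid := ⟨x, mem_interior_innerDual hc hx⟩
  pointed y hy hy' := span_eq_top_iff_forall_inner_eq_zero.1 hS y fun f hf => by
    have hfy := hy' hf
    rw [innerₗ_apply_apply, inner_neg_right, Left.nonneg_neg_iff] at hfy
    exact le_antisymm hfy (hy hf)

lemma isConeLinearAbsoluteNorm_coneSeminorm {C : PointedCone ℝ (Vec n)}
    (hC : IsProperCone (C : Set (Vec n))) (f : Vec n →L[ℝ] ℝ) (hf : ∀ x ∈ C, 0 ≤ f x) {c : ℝ}
    (hc : 0 < c) (hfc : ∀ x ∈ C, c * ‖x‖ ≤ f x) :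
    IsConeLinearAbsoluteNorm
      (coneSeminorm (f := f) (isReproducing_of_interior_nonempty hC.solid) hf) := by
  refine ⟨fun x hx => ?_, C, hC, ⟨(InnerProductSpace.toDual ℝ _).symm f, fun x hx => ?_,
    fun x hx => ?_⟩, fun x => ?_⟩
  · have h := mul_norm_le_coneSeminorm (f := f) (isReproducing_of_interior_nonempty hC.solid) hf
      hc.le hfc x
    rw [hx] at h
    exact norm_le_zero_iff.1 (nonpos_of_mul_nonpos_right h hc)
  · rw [InnerProductSpace.toDual_symm_apply]
    exact hf x hx
  · rw [InnerProductSpace.toDual_symm_apply]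
    exact coneSeminorm_of_mem _ hf hx
  · have h := isGLB_coneSeminorm (f := f) (isReproducing_of_interior_nonempty hC.solid) hf x
    rwa [← coneSeminorm_splitValues_eq (isReproducing_of_interior_nonempty hC.solid) hf] at h

end EuclideanCone

/-! ### Kronecker products -/

section Kronecker

variable {n p : ℕ}

/-- The Kronecker product `x₁ ⊗ ⋯ ⊗ x_p` of vectors, with the ordering of entries of `kronPow`. -/
noncomputable def kronVec (n p : ℕ) : MultilinearMap ℝ (fun _ : Fin p => Vec n) (Vec (n ^ p)) :=
  (WithLp.linearEquiv 2 ℝ _).symm.toLinearMap.compMultilinearMap <| .pi fun i =>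
    (MultilinearMap.mkPiAlgebra ℝ (Fin p) ℝ).compLinearMap fun j =>
      (EuclideanSpace.proj (finFunctionFinEquiv.symm i j)).toLinearMap

lemma kronVec_apply (x : Fin p → Vec n) (i : Fin (n ^ p)) :
    kronVec n p x i = ∏ j, x j (finFunctionFinEquiv.symm i j) := by
  simp [kronVec]

lemma kronPow_eq_kronVec (x : Vec n) : kronPow p x = kronVec n p fun _ => x := by
  ext i
  rw [kronVec_apply]
  rfl

lemma sum_prod_digits {R : Type*} [CommSemiring R] (g : Fin p → Fin n → R) :
    ∑ i : Fin (n ^ p), ∏ j, g j (finFunctionFinEquiv.symm i j) = ∏ j, ∑ k, g j k := by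
  rw [Equiv.sum_comp finFunctionFinEquiv.symm fun x : Fin p → Fin n => ∏ j, g j (x j)]
  exact (Fintype.prod_sum g).symm

lemma inner_kronVec (x y : Fin p → Vec n) :
    inner ℝ (kronVec n p x) (kronVec n p y) = ∏ j, inner ℝ (x j) (y j) := by
  simp only [PiLp.inner_apply, kronVec_apply, ← sum_prod_digits]
  simp [Finset.prod_mul_distrib]

lemma norm_kronVec (x : Fin p → Vec n) : ‖kronVec n p x‖ = ∏ j, ‖x j‖ := by
  rw [← sq_eq_sq₀ (norm_nonneg _) (by positivity), ← Finset.prod_pow,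
    ← real_inner_self_eq_norm_sq, inner_kronVec]
  simp only [real_inner_self_eq_norm_sq]

lemma norm_kronPow (x : Vec n) : ‖kronPow p x‖ = ‖x‖ ^ p := by
  rw [kronPow_eq_kronVec, norm_kronVec, Finset.prod_const, Finset.card_univ, Fintype.card_fin]

lemma kronVec_single (i : Fin (n ^ p)) :
    kronVec n p (fun j => EuclideanSpace.single (finFunctionFinEquiv.symm i j) 1) =
      EuclideanSpace.single i 1 := by
  ext i'
  have hdigits : (∀ j, finFunctionFinEquiv.symm i' j = finFunctionFinEquiv.symm i j) ↔ i' = i := by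
    rw [← funext_iff, finFunctionFinEquiv.symm.injective.eq_iff]
  simp [kronVec_apply, Finset.prod_ite_zero, hdigits]

lemma span_kronVec_eq_top {T : Set (Vec n)} (hT : Submodule.span ℝ T = ⊤) :
    Submodule.span ℝ (kronVec n p '' {f | ∀ j, f j ∈ T}) = ⊤ := by
  refine span_eq_top_iff_forall_inner_eq_zero.2 fun z hz => ?_
  have hzero : (innerₗ _ z).compMultilinearMap (kronVec n p) = 0 :=
    Module.Basis.ext_multilinear (fun _ => Module.Basis.ofSpan hT.ge) fun v => by
      refine (real_inner_comm _ _).trans (hz _ ⟨_, fun j => ?_, rfl⟩)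
      exact Module.Basis.ofSpan_subset hT.ge (mem_range_self (v j))
  ext i
  have hi := congrArg (fun φ => φ fun j => EuclideanSpace.single (finFunctionFinEquiv.symm i j) 1)
    hzero
  simpa [kronVec_single, EuclideanSpace.inner_single_right] using hi

/-- The Kronecker power `A^{⊗p}`, as a monoid homomorphism. -/
def kronMat (n p : ℕ) : Mat n →* Mat (n ^ p) where
  toFun A := .of fun i i' => ∏ j, A (finFunctionFinEquiv.symm i j) (finFunctionFinEquiv.symm i' j)
  map_one' := by
    ext i i'
    have hdigits :
        (∀ j, finFunctionFinEquiv.symm i j = finFunctionFinEquiv.symm i' j) ↔ i = i' := by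
      rw [← funext_iff, finFunctionFinEquiv.symm.injective.eq_iff]
    simp [Matrix.one_apply, Finset.prod_ite_zero, hdigits]
  map_mul' A B := by
    ext i i'
    simp only [Matrix.mul_apply, Matrix.of_apply, ← Finset.prod_mul_distrib]
    exact (sum_prod_digits fun j k => A (finFunctionFinEquiv.symm i j) k *
      B k (finFunctionFinEquiv.symm i' j)).symm

lemma kronMat_apply (A : Mat n) (i i' : Fin (n ^ p)) : kronMat n p A i i' =
    ∏ j, A (finFunctionFinEquiv.symm i j) (finFunctionFinEquiv.symm i' j) := rfl

lemma kronMat_conjTranspose (A : Mat n) : kronMat n p A.conjTranspose =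
    (kronMat n p A).conjTranspose := by
  ext i i'
  simp [kronMat_apply]

lemma act_kronMat_kronVec (A : Mat n) (x : Fin p → Vec n) :
    act (kronMat n p A) (kronVec n p x) = kronVec n p fun j => act A (x j) := by
  ext i
  change ∑ i', kronMat n p A i i' * kronVec n p x i' = _
  simp only [kronMat_apply, kronVec_apply, ← Finset.prod_mul_distrib]
  exact sum_prod_digits fun j k => A (finFunctionFinEquiv.symm i j) k * x j k

lemma act_kronMat_kronPow (A : Mat n) (x : Vec n) :
    act (kronMat n p A) (kronPow p x) = kronPow p (act A x) := by
  simp only [kronPow_eq_kronVec, act_kronMat_kronVec]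

/-- The Kronecker product `A₁ ⊗ ⋯ ⊗ A_p` of matrices. -/
noncomputable def kronMatMultilinear (n p : ℕ) :
    MultilinearMap ℝ (fun _ : Fin p => Mat n) (Mat (n ^ p)) :=
  .pi fun i => .pi fun i' => (MultilinearMap.mkPiAlgebra ℝ (Fin p) ℝ).compLinearMap fun j =>
    Matrix.entryLinearMap ℝ ℝ (finFunctionFinEquiv.symm i j) (finFunctionFinEquiv.symm i' j)

lemma kronMatMultilinear_apply (A : Fin p → Mat n) (i i' : Fin (n ^ p)) :
    kronMatMultilinear n p A i i' =
      ∏ j, A j (finFunctionFinEquiv.symm i j) (finFunctionFinEquiv.symm i' j) := rfl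

lemma continuous_kronMatMultilinear : Continuous (kronMatMultilinear n p) := by
  refine continuous_matrix fun i i' => ?_
  simp only [kronMatMultilinear_apply]
  exact continuous_finsetProd _ fun j _ => (continuous_apply j).matrix_elem _ _

lemma kronMat_eq_kronMatMultilinear (A : Mat n) :
    kronMat n p A = kronMatMultilinear n p fun _ => A := by
  ext i i'
  rw [kronMat_apply, kronMatMultilinear_apply]

lemma continuous_kronMat : Continuous (kronMat n p) := by
  simp only [funext kronMat_eq_kronMatMultilinear]
  exact continuous_kronMatMultilinear.comp (continuous_pi fun _ => continuous_id)

lemma exists_norm_kronMat_le (n p : ℕ) : ∃ C, 0 < C ∧ ∀ A, ‖kronMat n p A‖ ≤ C * ‖A‖ ^ p := by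
  obtain ⟨C, hC, h⟩ :=
    (kronMatMultilinear n p).exists_bound_of_continuous continuous_kronMatMultilinear
  exact ⟨C, hC, fun A => by simpa [kronMat_eq_kronMatMultilinear] using h fun _ => A⟩

end Kronecker

/-! ### The tensor power of a cone -/

section KronCone

variable {n : ℕ} {p : ℕ} {K : Set (Vec n)}

/-- The `p`-th tensor power of the cone `K`: the vectors of `ℝ^{n^p}` on which the Kronecker
products of functionals in the dual cone of `K` are nonnegative. -/
noncomputable def kronCone (p : ℕ) (K : Set (Vec n)) : ProperCone ℝ (Vec (n ^ p)) :=
  .innerDual (kronVec n p '' {f | ∀ j, f j ∈ ProperCone.innerDual K})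

lemma isProperCone_kronCone (p : ℕ) (hK : IsProperCone K) :
    IsProperCone (kronCone p K : Set (Vec (n ^ p))) := by
  obtain ⟨x, hx⟩ := hK.solid
  obtain ⟨c, hc, hcx⟩ := exists_mul_norm_le_inner_of_mem_interior hx
  refine isProperCone_innerDual (x := kronVec n p fun _ => x)
    (span_kronVec_eq_top (span_innerDual_eq_top (C := hK.toProperCone) hK.pointed))
    (pow_pos hc p) ?_
  rintro _ ⟨f, hf, rfl⟩
  calc c ^ p * ‖kronVec n p f‖ = ∏ j, c * ‖f j‖ := by
        simp [norm_kronVec, Finset.prod_mul_distrib]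
    _ ≤ ∏ j, inner ℝ (f j) x :=
        Finset.prod_le_prod (fun j _ => by positivity) fun j _ => hcx _ (hf j)
    _ = inner ℝ (kronVec n p f) (kronVec n p fun _ => x) := (inner_kronVec _ _).symm

lemma inner_act_conjTranspose (A : Mat n) (x y : Vec n) :
    inner ℝ (act A.conjTranspose x) y = inner ℝ x (act A y) := by
  rw [act, Matrix.toEuclideanLin_conjTranspose_eq_adjoint, LinearMap.adjoint_inner_left, act]

lemma act_kronMat_mem_kronCone {A : Mat n} (hA : ∀ x ∈ K, act A x ∈ K) {z : Vec (n ^ p)}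
    (hz : z ∈ kronCone p K) : act (kronMat n p A) z ∈ kronCone p K := by
  rintro _ ⟨f, hf, rfl⟩
  rw [innerₗ_apply_apply, ← inner_act_conjTranspose, ← kronMat_conjTranspose, act_kronMat_kronVec]
  refine hz ⟨_, fun j x hx => ?_, rfl⟩
  rw [innerₗ_apply_apply, real_inner_comm, inner_act_conjTranspose, real_inner_comm]
  exact hf j (hA x hx)

end KronCone

/-! ### Products of independent random matrices -/

section NormedRing

lemma norm_mul_pow_le {R : Type*} [NormedRing R] (p : ℕ) (x y : R) :
    ‖x * y‖ ^ p ≤ ‖x‖ ^ p * ‖y‖ ^ p := by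
  simpa only [mul_pow] using pow_le_pow_left₀ (norm_nonneg _) (norm_mul_le x y) p

variable {R : Type*} [NormedRing R] [MeasurableSpace R] [OpensMeasurableSpace R] [MeasurableMul₂ R]
  {μ ν : Measure R} {p : ℕ}

lemma integrable_norm_pow_mconv (hμ : Integrable (fun x => ‖x‖ ^ p) μ)
    (hν : Integrable (fun x => ‖x‖ ^ p) ν) : Integrable (fun x => ‖x‖ ^ p) (μ ∗ₘ ν) := by
  rw [Measure.mconv, integrable_map_measure (measurable_norm.pow_const p).aestronglyMeasurable
    measurable_mul.aemeasurable]
  refine (hμ.mul_prod hν).mono'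
    ((measurable_norm.comp measurable_mul).pow_const p).aestronglyMeasurable
    (ae_of_all _ fun x => ?_)
  simpa using norm_mul_pow_le p x.1 x.2

lemma integral_norm_pow_mconv_le [SFinite μ] [SFinite ν]
    (hμ : Integrable (fun x => ‖x‖ ^ p) μ)
    (hν : Integrable (fun x => ‖x‖ ^ p) ν) :
    ∫ x, ‖x‖ ^ p ∂(μ ∗ₘ ν) ≤ (∫ x, ‖x‖ ^ p ∂μ) * ∫ x, ‖x‖ ^ p ∂ν := by
  rw [Measure.mconv, integral_map measurable_mul.aemeasurable
    (measurable_norm.pow_const p).aestronglyMeasurable, ← integral_prod_mul]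
  exact integral_mono_of_nonneg (ae_of_all _ fun _ => by positivity) (hμ.mul_prod hν)
    (ae_of_all _ fun x => norm_mul_pow_le p x.1 x.2)

end NormedRing

lemma integrable_norm_pow_of_isBounded_support {E : Type*} [NormedAddCommGroup E]
    [MeasurableSpace E] [OpensMeasurableSpace E] [HereditarilyLindelofSpace E] {μ : Measure E}
    [IsFiniteMeasure μ] (h : Bornology.IsBounded μ.support) (p : ℕ) :
    Integrable (fun x => ‖x‖ ^ p) μ := by
  obtain ⟨R, hR⟩ := h.exists_norm_le
  refine .of_bound (measurable_norm.pow_const p).aestronglyMeasurable (R ^ p) ?_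
  filter_upwards [Measure.support_mem_ae (μ := μ)] with x hx
  simpa using pow_le_pow_left₀ (norm_nonneg x) (hR x hx) p

section RandomProduct

variable {n p : ℕ} {μ : Measure (Mat n)} [IsProbabilityMeasure μ]

lemma measurable_matProd (k : ℕ) : Measurable fun A : ℕ → Mat n => matProd A k := by
  induction k with
  | zero => exact measurable_const
  | succ k ih => exact (measurable_pi_apply k).mul ih

lemma matProd_congr {A B : ℕ → Mat n} {k : ℕ} (h : ∀ i < k, A i = B i) :
    matProd A k = matProd B k := by
  induction k with
  | zero => rfl
  | succ k ih =>
    rw [matProd, matProd, h k k.lt_succ_self, ih fun i hi => h i (hi.trans k.lt_succ_self)]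

instance instIsProbabilityMeasureIidLaw : IsProbabilityMeasure (iidLaw μ) :=
  inferInstanceAs (IsProbabilityMeasure (Measure.infinitePi fun _ : ℕ => μ))

variable (μ) in
/-- The law of the product `A_{k-1} ⋯ A_0` of independent random matrices following `μ`. -/
noncomputable def prodLaw (k : ℕ) : Measure (Mat n) :=
  (iidLaw μ).map fun A => matProd A k

instance instIsProbabilityMeasureProdLaw (k : ℕ) : IsProbabilityMeasure (prodLaw μ k) :=
  Measure.isProbabilityMeasure_map (measurable_matProd k).aemeasurable

variable (μ) in
lemma indepFun_eval_matProd (k : ℕ) : ProbabilityTheory.IndepFun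
    (fun A : ℕ → Mat n => A k) (fun A => matProd A k) (iidLaw μ) := by
  have hindep : ProbabilityTheory.iIndepFun (fun (i : ℕ) (A : ℕ → Mat n) => A i) (iidLaw μ) :=
    ProbabilityTheory.iIndepFun_infinitePi (X := fun _ A => A) fun _ => measurable_id
  let prodOfFirst (t : (i : Finset.range k) → Mat n) : Mat n :=
    matProd (fun i => if hi : i ∈ Finset.range k then t ⟨i, hi⟩ else 1) k
  have hmeas : Measurable prodOfFirst := by
    refine (measurable_matProd k).comp (measurable_pi_lambda _ fun i => ?_)
    split_ifs with hi
    exacts [measurable_pi_apply _, measurable_const]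
  have hcomp := (hindep.indepFun_finset {k} (Finset.range k) (by simp) measurable_pi_apply).comp
    (measurable_pi_apply ⟨k, Finset.mem_singleton_self k⟩) hmeas
  refine hcomp.congr (ae_of_all _ fun A => rfl) (ae_of_all _ fun A => matProd_congr fun i hi => ?_)
  simp [hi]

variable (μ) in
lemma prodLaw_zero : prodLaw μ 0 = Measure.dirac 1 := by
  simp [prodLaw, matProd]

variable (μ) in
lemma prodLaw_succ (k : ℕ) : prodLaw μ (k + 1) = μ ∗ₘ prodLaw μ k := by
  have hmap := (indepFun_eval_matProd μ k).map_mul_eq_map_mconv_map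
    (measurable_pi_apply k) (measurable_matProd k)
  rwa [iidLaw, Measure.infinitePi_map_eval] at hmap

variable (μ) in
lemma prodLaw_add (j k : ℕ) : prodLaw μ (j + k) = prodLaw μ j ∗ₘ prodLaw μ k := by
  induction j with
  | zero => rw [prodLaw_zero, Measure.dirac_one_mconv, zero_add]
  | succ j ih => rw [Nat.succ_add, prodLaw_succ, ih, prodLaw_succ, Measure.mconv_assoc]

lemma integrable_norm_pow_prodLaw (hμ : Integrable (fun A => ‖A‖ ^ p) μ) (k : ℕ) :
    Integrable (fun P => ‖P‖ ^ p) (prodLaw μ k) := by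
  induction k with
  | zero => rw [prodLaw_zero]; exact integrable_dirac (by simp)
  | succ k ih => rw [prodLaw_succ]; exact integrable_norm_pow_mconv hμ ih

variable (p μ) in
/-- The moment `E ‖A_{k-1} ⋯ A_0‖^p`. -/
noncomputable def moment (k : ℕ) : ℝ := ∫ P, ‖P‖ ^ p ∂prodLaw μ k

lemma moment_eq_integral_matProd (k : ℕ) :
    moment p μ k = ∫ A, ‖matProd A k‖ ^ p ∂iidLaw μ :=
  integral_map (measurable_matProd k).aemeasurable
    (measurable_norm.pow_const p).aestronglyMeasurable

lemma moment_nonneg (k : ℕ) : 0 ≤ moment p μ k := integral_nonneg fun _ => by positivity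

lemma moment_add_le (hμ : Integrable (fun A => ‖A‖ ^ p) μ) (j k : ℕ) :
    moment p μ (j + k) ≤ moment p μ j * moment p μ k := by
  rw [moment, prodLaw_add]
  exact integral_norm_pow_mconv_le (integrable_norm_pow_prodLaw hμ j)
    (integrable_norm_pow_prodLaw hμ k)

lemma tendsto_moment_root (hμ : Integrable (fun A => ‖A‖ ^ p) μ) :
    Tendsto (fun k : ℕ => moment p μ k ^ ((1 : ℝ) / (p * k))) atTop (𝓝 (pRadius p μ)) := by
  have hlim : ∃ L, Tendsto (fun k : ℕ => moment p μ k ^ ((1 : ℝ) / (p * k))) atTop (𝓝 L) := by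
    obtain ⟨L, hL⟩ := exists_tendsto_root_of_submultiplicative moment_nonneg (moment_add_le hμ)
    refine ⟨L ^ ((1 : ℝ) / p), (hL.rpow_const (.inr (by positivity))).congr fun k => ?_⟩
    rw [← Real.rpow_mul (moment_nonneg k), mul_comm, one_div_mul_one_div]
  simpa only [pRadius, moment_eq_integral_matProd] using tendsto_nhds_limUnder hlim

lemma pRadius_nonneg (hμ : Integrable (fun A => ‖A‖ ^ p) μ) : 0 ≤ pRadius p μ :=
  ge_of_tendsto' (tendsto_moment_root hμ) fun k => Real.rpow_nonneg (moment_nonneg k) _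

lemma moment_isLittleO (hp : p ≠ 0) (hμ : Integrable (fun A => ‖A‖ ^ p) μ) {γ : ℝ}
    (hγ : pRadius p μ < γ) : moment p μ =o[atTop] fun k => (γ ^ p) ^ k := by
  refine isLittleO_pow_of_tendsto_root moment_nonneg
    (((tendsto_moment_root hμ).pow p).congr fun k => ?_)
    (pow_lt_pow_left₀ hγ (pRadius_nonneg hμ) hp)
  rw [← Real.rpow_natCast, ← Real.rpow_mul (moment_nonneg k), ← one_div_mul_one_div_rev, mul_assoc,
    one_div_mul_cancel (Nat.cast_ne_zero.2 hp), mul_one]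

end RandomProduct

/-! ### The mean Kronecker power -/

lemma integral_monoidHom_mconv {M 𝔸 : Type*} [Monoid M] [MeasurableSpace M] [MeasurableMul₂ M]
    [NormedRing 𝔸] [NormedAlgebra ℝ 𝔸] [CompleteSpace 𝔸] {μ ν : Measure M} [SFinite μ] [SFinite ν]
    (φ : M →* 𝔸) (hφ : StronglyMeasurable φ) (hμ : Integrable φ μ) (hν : Integrable φ ν) :
    ∫ x, φ x ∂(μ ∗ₘ ν) = (∫ x, φ x ∂μ) * ∫ x, φ x ∂ν := by
  rw [Measure.mconv, integral_map measurable_mul.aemeasurable hφ.aestronglyMeasurable]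
  simpa only [map_mul, ContinuousLinearMap.mul_apply'] using
    integral_prod_bilin (ContinuousLinearMap.mul ℝ 𝔸) hμ hν

section KronMean

variable {n p : ℕ} {μ : Measure (Mat n)}

lemma stronglyMeasurable_kronMat : StronglyMeasurable (kronMat n p) :=
  continuous_kronMat.stronglyMeasurable

lemma integrable_kronMat (hμ : Integrable (fun A => ‖A‖ ^ p) μ) : Integrable (kronMat n p) μ := by
  obtain ⟨C, -, hC⟩ := exists_norm_kronMat_le n p
  exact (hμ.const_mul C).mono' stronglyMeasurable_kronMat.aestronglyMeasurable (ae_of_all _ hC)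

variable (p μ) in
/-- The matrix `E[A^{⊗p}]`. -/
noncomputable def kronMean : Mat (n ^ p) := ∫ A, kronMat n p A ∂μ

lemma kronMean_pow [IsProbabilityMeasure μ] (hμ : Integrable (fun A => ‖A‖ ^ p) μ) (k : ℕ) :
    kronMean p μ ^ k = kronMean p (prodLaw μ k) := by
  induction k with
  | zero => simp [prodLaw_zero, kronMean]
  | succ k ih =>
    rw [pow_succ', ih, prodLaw_succ]
    exact (integral_monoidHom_mconv _ stronglyMeasurable_kronMat (integrable_kronMat hμ)
      (integrable_kronMat (integrable_norm_pow_prodLaw hμ k))).symm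

lemma kronMean_pow_isBigO [IsProbabilityMeasure μ] (hμ : Integrable (fun A => ‖A‖ ^ p) μ) :
    (fun k => kronMean p μ ^ k) =O[atTop] moment p μ := by
  obtain ⟨C, -, hC⟩ := exists_norm_kronMat_le n p
  refine .of_bound C (.of_forall fun k => ?_)
  rw [kronMean_pow hμ, Real.norm_of_nonneg (moment_nonneg k), moment, ← integral_const_mul]
  exact norm_integral_le_of_norm_le ((integrable_norm_pow_prodLaw hμ k).const_mul C)
    (ae_of_all _ hC)

/-- The matrix-vector product `A x` as a function of `A`. -/
noncomputable def actCLM (x : Vec n) : Mat n →L[ℝ] Vec n :=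
  ((LinearMap.applyₗ x).comp Matrix.toEuclideanLin.toLinearMap).toContinuousLinearMap

lemma integrable_apply_act_kronMat (hμ : Integrable (fun A => ‖A‖ ^ p) μ)
    (f : Vec (n ^ p) →L[ℝ] ℝ) (z : Vec (n ^ p)) :
    Integrable (fun A => f (act (kronMat n p A) z)) μ :=
  (f ∘L actCLM z).integrable_comp (integrable_kronMat hμ)

lemma integral_apply_act_kronMat (hμ : Integrable (fun A => ‖A‖ ^ p) μ)
    (f : Vec (n ^ p) →L[ℝ] ℝ) (z : Vec (n ^ p)) :
    ∫ A, f (act (kronMat n p A) z) ∂μ = f (act (kronMean p μ) z) :=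
  (f ∘L actCLM z).integral_comp_comm (integrable_kronMat hμ)

lemma act_kronMean_mem_kronCone (hμ : Integrable (fun A => ‖A‖ ^ p) μ) {K : Set (Vec n)}
    (hinv : LeavesInvariant μ.support K) {z : Vec (n ^ p)} (hz : z ∈ kronCone p K) :
    act (kronMean p μ) z ∈ kronCone p K := by
  intro f hf
  change 0 ≤ innerSL ℝ f _
  rw [← integral_apply_act_kronMat hμ]
  refine integral_nonneg_of_ae ?_
  filter_upwards [Measure.support_mem_ae (μ := μ)] with A hA
  exact act_kronMat_mem_kronCone (hinv A hA) hz hf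

lemma exists_contracted_functional_kronCone [IsProbabilityMeasure μ] (hp : p ≠ 0)
    (hμ : Integrable (fun A => ‖A‖ ^ p) μ) {K : Set (Vec n)} (hK : IsProperCone K)
    (hinv : LeavesInvariant μ.support K) {γ : ℝ} (hγ : pRadius p μ < γ) :
    ∃ f : Vec (n ^ p) →L[ℝ] ℝ, ∃ c, 0 < c ∧ (∀ z ∈ kronCone p K, c * ‖z‖ ≤ f z) ∧
      ∀ z ∈ kronCone p K, f (act (kronMean p μ) z) ≤ γ ^ p * f z := by
  obtain ⟨f₀, c, hc, hf₀⟩ := exists_mul_norm_le_inner (isProperCone_kronCone p hK).pointed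
  have hdecay : (fun k => Matrix.toEuclideanCLM (𝕜 := ℝ) (kronMean p μ) ^ k) =o[atTop]
      fun k => (γ ^ p) ^ k := by
    simp only [← map_pow]
    exact .of_norm_left
      ((kronMean_pow_isBigO hμ).trans_isLittleO (moment_isLittleO hp hμ hγ)).norm_left
  obtain ⟨f, hf⟩ := exists_contracted_functional (S := kronCone p K) (f₀ := innerSL ℝ f₀)
    (fun z hz => act_kronMean_mem_kronCone hμ hinv hz) hc hf₀
    (pow_pos ((pRadius_nonneg hμ).trans_lt hγ) p) hdecay
  exact ⟨f, c, hc, hf⟩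

end KronMean

/-! ### Seminorms of Kronecker powers -/

lemma continuous_seminorm_of_finiteDimensional {E : Type*} [NormedAddCommGroup E] [NormedSpace ℝ E]
    [FiniteDimensional ℝ E] (N : Seminorm ℝ E) : Continuous N :=
  N.convexOn.locallyLipschitz.continuous

section Lyapunov

variable {n p : ℕ}

lemma exists_seminorm_kronPow_le (N : Seminorm ℝ (Vec (n ^ p))) :
    ∃ C, 0 < C ∧ ∀ x, N (kronPow p x) ≤ C * ‖x‖ ^ p := by
  obtain ⟨C, hC, hN⟩ :=
    N.bound_of_continuous_normedSpace (continuous_seminorm_of_finiteDimensional N)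
  exact ⟨C, hC, fun x => (hN _).trans_eq (by rw [norm_kronPow])⟩

lemma integrable_seminorm_kronPow_act {μ : Measure (Mat n)}
    (hμ : Integrable (fun A => ‖A‖ ^ p) μ) (N : Seminorm ℝ (Vec (n ^ p))) (x : Vec n) :
    Integrable (fun A => N (kronPow p (act A x))) μ := by
  simp only [← act_kronMat_kronPow]
  obtain ⟨C, -, hN⟩ :=
    N.bound_of_continuous_normedSpace (continuous_seminorm_of_finiteDimensional N)
  have hint := (actCLM (kronPow p x)).integrable_comp (integrable_kronMat hμ)
  refine (hint.norm.const_mul C).mono'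
    ((continuous_seminorm_of_finiteDimensional N).comp_aestronglyMeasurable hint.1)
    (ae_of_all _ fun A => ?_)
  rw [Real.norm_of_nonneg (apply_nonneg N _)]
  exact hN _

end Lyapunov

end SwitchedLinear

open SwitchedLinear in
theorem mainTheorem4_general (n p : ℕ) (hp : 1 ≤ p) (μ : Measure (Mat n)) [IsProbabilityMeasure μ]
    (hμ : Integrable (fun A => ‖A‖ ^ p) μ)
    (hcone : ∃ K : Set (Vec n), IsProperCone K ∧ LeavesInvariant μ.support K)
    (γ : ℝ) (hγ : γ ∈ Set.Ioo (pRadius p μ) 1) :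
    ∃ N : Seminorm ℝ (Vec (n ^ p)), IsConeLinearAbsoluteNorm N ∧
      IsStochLyapunov p μ (fun x => N (kronPow p x)) γ := by
  obtain ⟨K, hK, hinv⟩ := hcone
  have hKp := isProperCone_kronCone p hK
  have hγ₀ := (pRadius_nonneg hμ).trans_lt hγ.1
  obtain ⟨f, c, hc, hfc, hcontr⟩ :=
    exists_contracted_functional_kronCone (Nat.ne_zero_of_lt hp) hμ hK hinv hγ.1
  have hf : ∀ z ∈ kronCone p K, 0 ≤ f z := fun z hz =>
    (mul_nonneg hc.le (norm_nonneg z)).trans (hfc z hz)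
  let N := coneSeminorm (f := f) (isReproducing_of_interior_nonempty hKp.solid) hf
  obtain ⟨C, hC, hNC⟩ := exists_seminorm_kronPow_le N
  refine ⟨N, isConeLinearAbsoluteNorm_coneSeminorm hKp f hf hc hfc,
    ⟨c, C, hc, hC, fun x => ⟨?_, hNC x⟩⟩, hγ₀.le, hγ.2, integrable_seminorm_kronPow_act hμ N,
    fun x => ?_⟩
  · rw [← norm_kronPow]
    exact mul_norm_le_coneSeminorm _ hf hc.le hfc _
  · simp only [← act_kronMat_kronPow]
    refine integral_coneSeminorm_le (T := fun A => Matrix.toEuclideanLin (kronMat n p A)) _ hf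
      ?_ (fun z _ => integrable_apply_act_kronMat hμ f z) (by positivity) (fun z hz => ?_) _
    · filter_upwards [Measure.support_mem_ae (μ := μ)] with A hA z hz
      exact act_kronMat_mem_kronCone (hinv A hA) hz
    · exact (integral_apply_act_kronMat hμ f z).trans_le (hcontr z hz)

theorem mainTheorem4 (n p : ℕ) (hp : 1 ≤ p)
    (μ : Measure (SwitchedLinear.Mat n)) [IsProbabilityMeasure μ]
    (hbdd : Bornology.IsBounded μ.support)
    (hstable : SwitchedLinear.IsMeanStable p μ)
    (hcone : ∃ K : Set (SwitchedLinear.Vec n), SwitchedLinear.IsProperCone K ∧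
      SwitchedLinear.LeavesInvariant μ.support K)
    (γ : ℝ) (hγ : γ ∈ Set.Ioo (SwitchedLinear.pRadius p μ) 1) :
    ∃ N : Seminorm ℝ (SwitchedLinear.Vec (n ^ p)),
      SwitchedLinear.IsConeLinearAbsoluteNorm N ∧
      SwitchedLinear.IsStochLyapunov p μ
        (fun x => N (SwitchedLinear.kronPow p x)) γ :=
  mainTheorem4_general n p hp μ (SwitchedLinear.integrable_norm_pow_of_isBounded_support hbdd p)
    hcone γ hγ
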